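/- Let $\psi_i(x)=r_ix+w_i$, $1\le i\le q$, with $0<r_i<1$ and $w_i\in\mathbb{R}^3$, and let $K\subset\mathbb{R}^3$ be the self-similar set without rotations that they generate, i.e. the unique nonempty compact set with $K=\bigcup_{i=1}^q\psi_i(K)$. For a two-dimensional linear subspace $V\subset\mathbb{R}^3$ let $\pi_V:\mathbb{R}^3\to V$ be the orthogonal projection, and let $B(0,R)$ denote the closed ball of radius $R$ centred at the origin. Then $K$ has the bi-Lipschitz property: for every two-dimensional subspace $V$ and every $\varepsilon>0$ there is a subset $K_{V,\varepsilon}\subset K$ such that $$\dim_{\mathrm H}K_{V,\varepsilon}\ \ge\ \dim_{\mathrm H}\pi_V(K)-\varepsilon$$ and the restriction $\pi_V|_{K_{V,\varepsilon}}$ is bi-Lipschitz. Moreover, $K_{V,\varepsilon}$ can be taken to be a self-similar set without rotations satisfying the very strong separation condition: whenever $R>0$ is such that $\psi_i(B(0,R))\subset B(0,R)$ for all $i$ (such $R$ always exists), $K_{V,\varepsilon}$ can be chosen as the attractor of finitely many maps $\varphi_j(x)=\rho_jx+v_j$, $0<\rho_j<1$, $v_j\in\mathbb{R}^3$, such that $\varphi_j(B(0,R))\subset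 B(0,R)$ for all $j$ and the balls $\varphi_j(B(0,R))$ are pairwise disjoint. -/

import Mathlib

open Set Metric
open scoped NNReal ENNReal

noncomputable section

/-- Euclidean three-space. -/
abbrev E3 : Type := EuclideanSpace ℝ (Fin 3)

/-- A finite family of contracting similitudes of `ℝ³` without rotations:
`ψ_i (x) = r_i x + w_i` with `0 < r_i < 1`. -/
structure HomothetyIFS (q : ℕ) where
  ratio : Fin q → ℝ
  shift : Fin q → E3
  ratio_pos : ∀ i, 0 < ratio i
  ratio_lt_one : ∀ i, ratio i < 1

namespace HomothetyIFS

variable {q : ℕ} (Ψ : HomothetyIFS q)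

/-- The `i`-th similitude of the family. -/
def map (i : Fin q) (x : E3) : E3 := Ψ.ratio i • x + Ψ.shift i

/-- `K` is the attractor of the family, i.e. the (unique) nonempty compact set with
`K = ⋃ i, ψ_i (K)`. -/
def IsAttractor (K : Set E3) : Prop :=
  K.Nonempty ∧ IsCompact K ∧ K = ⋃ i, Ψ.map i '' K

/-- Every similitude of the family maps the closed ball `B(0,R)` into itself. -/
def PreservesBall (R : ℝ) : Prop :=
  ∀ i, MapsTo (Ψ.map i) (closedBall 0 R) (closedBall 0 R)

/-- The very strong separation condition with respect to the reference ball `B(0,R)`: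
the similitudes map this closed ball into itself, and its images under the
similitudes (the balls of generation one) are pairwise disjoint. -/
def VerySeparated (R : ℝ) : Prop :=
  Ψ.PreservesBall R ∧
    Pairwise fun i j : Fin q =>
      Disjoint (Ψ.map i '' closedBall 0 R) (Ψ.map j '' closedBall 0 R)

/-- Every family admits a reference ball. -/
theorem exists_preservesBall : ∃ R : ℝ, 0 < R ∧ Ψ.PreservesBall R := by
  have h1 : ∀ i, 0 < 1 - Ψ.ratio i := fun i => sub_pos.2 (Ψ.ratio_lt_one i)
  have h0 : ∀ i ∈ Finset.univ, 0 ≤ ‖Ψ.shift i‖ / (1 - Ψ.ratio i) :=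
    fun i _ => div_nonneg (norm_nonneg _) (h1 i).le
  refine ⟨∑ i, ‖Ψ.shift i‖ / (1 - Ψ.ratio i) + 1,
    add_pos_of_nonneg_of_pos (Finset.sum_nonneg h0) one_pos, fun i x hx => ?_⟩
  have hi := Finset.single_le_sum h0 (Finset.mem_univ i)
  generalize ∑ i, ‖Ψ.shift i‖ / (1 - Ψ.ratio i) = S at hi hx ⊢
  rw [mem_closedBall_zero_iff] at hx ⊢
  rw [div_le_iff₀ (h1 i)] at hi
  calc ‖Ψ.ratio i • x + Ψ.shift i‖ ≤ ‖Ψ.ratio i • x‖ + ‖Ψ.shift i‖ := norm_add_le _ _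
    _ = Ψ.ratio i * ‖x‖ + ‖Ψ.shift i‖ := by
        rw [norm_smul, Real.norm_of_nonneg (Ψ.ratio_pos i).le]
    _ ≤ Ψ.ratio i * (S + 1) + S * (1 - Ψ.ratio i) := by
        have := mul_le_mul_of_nonneg_left hx (Ψ.ratio_pos i).le
        linarith
    _ ≤ S + 1 := by nlinarith [h1 i]

end HomothetyIFS

/-- The restriction of `f` to `s` is bi-Lipschitz. -/
def BiLipschitzOn {X Y : Type*} [PseudoEMetricSpace X] [PseudoEMetricSpace Y]
    (f : X → Y) (s : Set X) : Prop :=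
  (∃ C : ℝ≥0, LipschitzOnWith C f s) ∧ ∃ C : ℝ≥0, AntilipschitzWith C (s.domRestrict f)

/-- The bi-Lipschitz property: for every plane `V ∈ G(3,2)` and every `ε > 0` the set `B`
has a subset `A` with `dim_H A ≥ dim_H π_V(B) - ε` on which `π_V` is bi-Lipschitz. -/
def HasBiLipschitzProperty (B : Set E3) : Prop :=
  ∀ V : Submodule ℝ E3, Module.finrank ℝ V = 2 → ∀ ε : ℝ, 0 < ε →
    ∃ A : Set E3, A ⊆ B ∧
      dimH (V.orthogonalProjectionOnto '' B) ≤ dimH A + ENNReal.ofReal ε ∧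
      BiLipschitzOn V.orthogonalProjectionOnto A

end

/-!
If `d < dimH (π '' K)`, then at arbitrarily small scales `δ` the set `π '' K` contains more than a
constant times `δ ^ (-d)` points that are `δ`-separated. Over each of them choose a cylinder of `K`
whose size is a small multiple of `δ`. The images of the reference ball under the corresponding
compositions have disjoint projections, and their ratios `ρ` satisfy `∑ ρ ^ d ≥ 1`, so these
compositions form a very separated family whose attractor has dimension at least `d`. Since `π`
separates the first-generation pieces of this attractor and rescales in the same way as the
homotheties do, it is bi-Lipschitz there.
-/

section HausdorffMeasure

open MeasureTheory Filter Topology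

theorem exists_isOpen_superset_ediam_rpow_le {X : Type*} [PseudoEMetricSpace X] {t : Set X}
    (ht : ediam t ≠ ⊤) {d : ℝ} (hd : 0 ≤ d) {ε : ℝ≥0∞} (hε : ε ≠ 0) :
    ∃ U, IsOpen U ∧ t ⊆ U ∧ ediam U ^ d ≤ ediam t ^ d + ε := by
  have hcont : Continuous fun δ : ℝ≥0 => (ediam t + 2 * δ) ^ d :=
    ENNReal.continuous_rpow_const.comp <| continuous_const.add <|
      (ENNReal.continuous_const_mul ENNReal.ofNat_ne_top).comp ENNReal.continuous_coe
  have hlim : Tendsto (fun δ : ℝ≥0 => (ediam t + 2 * δ) ^ d) (𝓝[>] 0) (𝓝 (ediam t ^ d)) := by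
    simpa using (hcont.tendsto 0).mono_left nhdsWithin_le_nhds
  have hlt : ediam t ^ d < ediam t ^ d + ε :=
    ENNReal.lt_add_right (ENNReal.rpow_ne_top_of_nonneg hd ht) hε
  obtain ⟨δ, hδ, hδ0⟩ := ((hlim.eventually_lt_const hlt).and self_mem_nhdsWithin).exists
  exact ⟨thickening δ t, isOpen_thickening, self_subset_thickening hδ0 t,
    (ENNReal.rpow_le_rpow (ediam_thickening_le δ) hd).trans hδ.le⟩

theorem le_hausdorffMeasure_of_forall_finite_cover {X : Type*} [EMetricSpace X]
    [MeasurableSpace X] [BorelSpace X] {K : Set X} (hK : IsCompact K) {d : ℝ} (hd : 0 < d)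
    {c : ℝ≥0∞}
    (h : ∀ (J : Finset ℕ) (U : ℕ → Set X), K ⊆ ⋃ j ∈ J, U j → c ≤ ∑ j ∈ J, ediam (U j) ^ d) :
    c ≤ μH[d] K := by
  rw [Measure.hausdorffMeasure_apply]
  refine le_iSup₂_of_le 1 one_pos <| le_iInf fun t => le_iInf fun hKt => le_iInf fun ht => ?_
  refine ENNReal.le_of_forall_pos_le_add fun ε hε _ => ?_
  obtain ⟨ε', hε', hsum⟩ := ENNReal.exists_pos_sum_of_countable (ENNReal.coe_pos.2 hε).ne' ℕ
  have enlarge : ∀ n, ∃ U, IsOpen U ∧ t n ⊆ U ∧ ediam U ^ d ≤ ediam (t n) ^ d + ε' n := fun n =>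
    exists_isOpen_superset_ediam_rpow_le ((ht n).trans_lt ENNReal.one_lt_top).ne hd.le
      (ENNReal.coe_pos.2 (hε' n)).ne'
  choose U hUo htU hU using enlarge
  obtain ⟨J, hJ⟩ := hK.elim_finite_subcover U hUo (hKt.trans (iUnion_mono htU))
  have hterm : ∀ n, ediam (t n) ^ d ≤ ⨆ _ : (t n).Nonempty, ediam (t n) ^ d := fun n => by
    rcases (t n).eq_empty_or_nonempty with hn | hn
    · simp [hn, hd]
    · simp [hn]
  calc c ≤ ∑ j ∈ J, ediam (U j) ^ d := h J U hJ
    _ ≤ ∑ j ∈ J, (ediam (t j) ^ d + ε' j) := Finset.sum_le_sum fun j _ => hU j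
    _ ≤ ∑' j, (ediam (t j) ^ d + ε' j) := ENNReal.sum_le_tsum J
    _ = ∑' j, ediam (t j) ^ d + ∑' j, (ε' j : ℝ≥0∞) := ENNReal.tsum_add
    _ ≤ (∑' j, ⨆ _ : (t j).Nonempty, ediam (t j) ^ d) + ε :=
        add_le_add (ENNReal.tsum_le_tsum hterm) hsum.le

theorem exists_finset_isSeparated_isCover {X : Type*} [PseudoEMetricSpace X] {A : Set X}
    (hA : TotallyBounded A) {δ : ℝ≥0} (hδ : δ ≠ 0) :
    ∃ T : Finset X, (T : Set X) ⊆ A ∧ IsSeparated δ (T : Set X) ∧ IsCover δ A (T : Set X) := by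
  obtain ⟨N, -, hNfin, hN⟩ :=
    exists_finite_isCover_of_totallyBounded (ε := δ / 2) (by positivity) hA
  have hpack : packingNumber δ A < ⊤ :=
    calc packingNumber δ A = packingNumber (2 * (δ / 2)) A := by
          rw [mul_div_cancel₀ δ two_ne_zero]
      _ ≤ externalCoveringNumber (δ / 2) A := packingNumber_two_mul_le_externalCoveringNumber _ A
      _ ≤ N.encard := hN.externalCoveringNumber_le_encard
      _ < ⊤ := hNfin.encard_lt_top
  have hfin : (maximalSeparatedSet δ A).Finite := by
    rwa [← Set.encard_lt_top_iff, encard_maximalSeparatedSet hpack.ne]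
  refine ⟨hfin.toFinset, ?_⟩
  rw [hfin.coe_toFinset]
  exact ⟨maximalSeparatedSet_subset, isSeparated_maximalSeparatedSet,
    isCover_maximalSeparatedSet hpack.ne⟩

theorem dimH_le_of_eventually_exists_isCover {X : Type*} [EMetricSpace X] {A : Set X} {d C : ℝ≥0}
    (h : ∀ᶠ δ : ℝ≥0 in 𝓝[>] 0, ∃ T : Finset X, IsCover δ A (T : Set X) ∧
      (T.card : ℝ≥0) * δ ^ (d : ℝ) ≤ C) :
    dimH A ≤ d := by
  borelize X
  obtain ⟨T, hT⟩ := h.choice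
  refine dimH_le_of_hausdorffMeasure_ne_top (ne_top_of_le_ne_top
    (ENNReal.coe_ne_top (r := 2 ^ (d : ℝ) * C)) ?_)
  have hmesh : Tendsto (fun δ : ℝ≥0 => 2 * (δ : ℝ≥0∞)) (𝓝[>] 0) (𝓝 0) := by
    have : Continuous fun δ : ℝ≥0 => 2 * (δ : ℝ≥0∞) :=
      (ENNReal.continuous_const_mul ENNReal.ofNat_ne_top).comp ENNReal.continuous_coe
    simpa using (this.tendsto 0).mono_left nhdsWithin_le_nhds
  refine (Measure.hausdorffMeasure_le_liminf_sum (ι := fun δ => T δ) (d : ℝ) A _ hmesh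
    (fun δ x => closedEBall (x : X) δ) (.of_forall fun δ x => ediam_closedEBall_le) ?_).trans
    (liminf_le_of_frequently_le (hT.mono fun δ hδ => ?_).frequently)
  · filter_upwards [hT] with δ hδ
    have := isCover_iff_subset_iUnion_closedEBall.1 hδ.1
    rwa [iUnion_subtype]
  · calc ∑ x : T δ, ediam (closedEBall (x : X) δ) ^ (d : ℝ)
        ≤ ∑ _x : T δ, ((2 * δ : ℝ≥0) : ℝ≥0∞) ^ (d : ℝ) := by
          gcongr
          simpa using ediam_closedEBall_le
      _ = ((2 ^ (d : ℝ) * ((T δ).card * δ ^ (d : ℝ)) : ℝ≥0) : ℝ≥0∞) := by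
          rw [← ENNReal.coe_rpow_of_nonneg _ d.coe_nonneg, NNReal.mul_rpow]
          simp [mul_left_comm]
      _ ≤ ((2 ^ (d : ℝ) * C : ℝ≥0) : ℝ≥0∞) := by
          gcongr
          exact hδ.2

theorem exists_isSeparated_of_lt_dimH {X : Type*} [EMetricSpace X] {A : Set X}
    (hA : TotallyBounded A) {d : ℝ≥0} (hd : d < dimH A) {c δ₀ : ℝ≥0} (hc : 0 < c)
    (hδ₀ : 0 < δ₀) :
    ∃ δ : ℝ≥0, 0 < δ ∧ δ < δ₀ ∧ ∃ T : Finset X, (T : Set X) ⊆ A ∧ IsSeparated δ (T : Set X) ∧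
      1 ≤ (T.card : ℝ≥0) * (c * δ) ^ (d : ℝ) := by
  by_contra! hfew
  refine (dimH_le_of_eventually_exists_isCover (C := (c ^ (d : ℝ))⁻¹) ?_).not_gt hd
  filter_upwards [Ioo_mem_nhdsGT hδ₀] with δ ⟨hδ, hδ'⟩
  obtain ⟨T, hTA, hsep, hcover⟩ := exists_finset_isSeparated_isCover hA hδ.ne'
  refine ⟨T, hcover, ?_⟩
  have hcard := (hfew δ hδ hδ' T hTA hsep).le
  rwa [NNReal.mul_rpow, mul_left_comm, mul_comm, ← NNReal.le_inv_iff_mul_le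
    (NNReal.rpow_pos hc).ne'] at hcard

end HausdorffMeasure

/-- `L` is an attractor of the family of maps `φ`: a nonempty compact set with `L = ⋃ i, φ i (L)`.
For a finite family of contractions of a complete space there is exactly one such set. -/
def IsAttractorOf {ι X : Type*} [TopologicalSpace X] (φ : ι → X → X) (L : Set X) : Prop :=
  L.Nonempty ∧ IsCompact L ∧ L = ⋃ i, φ i '' L

namespace IsAttractorOf

variable {ι X : Type*} [TopologicalSpace X] {φ : ι → X → X} {L : Set X}

theorem nonempty (hL : IsAttractorOf φ L) : L.Nonempty := hL.1

theorem isCompact (hL : IsAttractorOf φ L) : IsCompact L := hL.2.1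

theorem mapsTo (hL : IsAttractorOf φ L) (i : ι) : MapsTo (φ i) L L := by
  rw [mapsTo_iff_image_subset]
  conv_rhs => rw [hL.2.2]
  exact subset_iUnion (fun i => φ i '' L) i

theorem exists_map_eq (hL : IsAttractorOf φ L) {x : X} (hx : x ∈ L) : ∃ i, ∃ y ∈ L, φ i y = x := by
  rw [hL.2.2] at hx
  exact mem_iUnion.1 hx

end IsAttractorOf

-- The attractor is the decreasing intersection of the iterates of `A ↦ ⋃ i, φ i (A)` on `K`;
-- injectivity and finiteness let this set map commute with the intersection.
theorem exists_isAttractorOf_subset {ι X : Type*} [Finite ι] [Nonempty ι] [TopologicalSpace X]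
    [T2Space X] {φ : ι → X → X} (hcont : ∀ i, Continuous (φ i))
    (hinj : ∀ i, Function.Injective (φ i)) {K : Set X} (hK : IsCompact K) (hne : K.Nonempty)
    (hmaps : ∀ i, MapsTo (φ i) K K) : ∃ L, IsAttractorOf φ L ∧ L ⊆ K := by
  let F : Set X → Set X := fun A => ⋃ i, φ i '' A
  have hF : Monotone F := fun A B h => iUnion_mono fun i => image_mono h
  have hanti : Antitone fun n => F^[n] K :=
    hF.antitone_iterate_of_map_le (iUnion_subset fun i => (hmaps i).image_subset)
  have hcompact : ∀ n, IsCompact (F^[n] K) := fun n =>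
    Function.Iterate.rec _ hK (fun A h => isCompact_iUnion fun i => h.image (hcont i)) n
  have hnonempty : ∀ n, (F^[n] K).Nonempty := fun n =>
    Function.Iterate.rec _ hne (fun A h => nonempty_iUnion.2 ⟨Classical.arbitrary ι, h.image _⟩) n
  have hsub : ⋂ n, F^[n] K ⊆ K := iInter_subset _ 0
  refine ⟨⋂ n, F^[n] K, ⟨?_, ?_, ?_⟩, hsub⟩
  · exact IsCompact.nonempty_iInter_of_sequence_nonempty_isCompact_isClosed _
      (fun n => hanti n.le_succ) hnonempty hK fun n => (hcompact n).isClosed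
  · exact hK.of_isClosed_subset (isClosed_iInter fun n => (hcompact n).isClosed) hsub
  · calc ⋂ n, F^[n] K = ⋂ n, F^[n + 1] K := (hanti.iInter_nat_add 1).symm
      _ = ⋂ n, ⋃ i, φ i '' (F^[n] K) := iInter_congr fun n => Function.iterate_succ_apply' F n K
      _ = ⋃ i, ⋂ n, φ i '' (F^[n] K) :=
          iInter_iUnion_of_antitone fun i m n h => image_mono (hanti h)
      _ = ⋃ i, φ i '' ⋂ n, F^[n] K :=
          iUnion_congr fun i => ((hinj i).injOn.image_iInter_eq).symm

/-- Applying `φ i` multiplies the distance pulled back along `g` by `r i`. For `g = id` this says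
that `φ i` is a similarity of ratio `r i`; a linear `g` inherits it from homotheties. -/
def ScalesBy {ι X Y : Type*} [PseudoMetricSpace Y] (φ : ι → X → X) (r : ι → ℝ≥0) (g : X → Y) :
    Prop :=
  ∀ i x y, dist (g (φ i x)) (g (φ i y)) = r i * dist (g x) (g y)

namespace ScalesBy

theorem image_image_subset_closedBall {ι X Y : Type*} [PseudoMetricSpace Y] {φ : ι → X → X}
    {r : ι → ℝ≥0} {g : X → Y} (h : ScalesBy φ r g) {B : Set X}
    (hB : Bornology.IsBounded (g '' B)) {z : X} (hz : z ∈ B) (i : ι) :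
    g '' (φ i '' B) ⊆ closedBall (g (φ i z)) (r i * diam (g '' B)) := by
  rintro _ ⟨_, ⟨b, hb, rfl⟩, rfl⟩
  rw [mem_closedBall, h i b z]
  gcongr
  exact dist_le_diam_of_mem hB (mem_image_of_mem g hb) (mem_image_of_mem g hz)

variable {ι X : Type*} [PseudoMetricSpace X] {φ : ι → X → X} {r : ι → ℝ≥0}

theorem lipschitzWith (hφ : ScalesBy φ r id) (i : ι) : LipschitzWith (r i) (φ i) :=
  LipschitzWith.of_dist_le_mul fun x y => (hφ i x y).le

theorem antilipschitzWith (hφ : ScalesBy φ r id) {i : ι} (hr : 0 < r i) :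
    AntilipschitzWith (r i)⁻¹ (φ i) :=
  AntilipschitzWith.of_le_mul_dist fun x y => by
    have : dist (φ i x) (φ i y) = r i * dist x y := hφ i x y
    rw [this, NNReal.coe_inv, inv_mul_cancel_left₀ (NNReal.coe_ne_zero.2 hr.ne')]

theorem rpow_mul_sum_ediam_preimage_le (hφ : ScalesBy φ r id) {i : ι} (hr : 0 < r i) {d : ℝ}
    (hd : 0 ≤ d) {κ : Type*} (J : Finset κ) (U : κ → Set X) :
    (r i : ℝ≥0∞) ^ d * ∑ j ∈ J, ediam (φ i ⁻¹' U j) ^ d ≤ ∑ j ∈ J, ediam (U j) ^ d := by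
  rw [Finset.mul_sum]
  refine Finset.sum_le_sum fun j _ => ?_
  rw [← ENNReal.mul_rpow_of_nonneg _ _ hd]
  refine ENNReal.rpow_le_rpow ?_ hd
  have hr' : (r i : ℝ≥0∞) ≠ 0 := ENNReal.coe_ne_zero.2 hr.ne'
  calc (r i : ℝ≥0∞) * ediam (φ i ⁻¹' U j) ≤ r i * (((r i)⁻¹ : ℝ≥0) * ediam (U j)) := by
        gcongr
        exact (hφ.antilipschitzWith hr).ediam_preimage_le (U j)
    _ = ediam (U j) := by
        rw [ENNReal.coe_inv hr.ne', ENNReal.mul_inv_cancel_left hr' ENNReal.coe_ne_top]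

end ScalesBy

theorem exists_pos_forall_le_edist {ι Y : Type*} [Finite ι] [EMetricSpace Y] {S : ι → Set Y}
    (hS : ∀ i, IsCompact (S i)) (hdisj : Pairwise fun i j => Disjoint (S i) (S j)) :
    ∃ a : ℝ≥0, 0 < a ∧ ∀ i j, i ≠ j → ∀ x ∈ S i, ∀ y ∈ S j, (a : ℝ≥0∞) ≤ edist x y := by
  have hpair : ∀ ij : ι × ι, ∃ a : ℝ≥0, 0 < a ∧ (ij.1 ≠ ij.2 →
      ∀ x ∈ S ij.1, ∀ y ∈ S ij.2, (a : ℝ≥0∞) ≤ edist x y) := by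
    rintro ⟨i, j⟩
    by_cases hij : i = j
    · exact ⟨1, one_pos, fun h => absurd hij h⟩
    · obtain ⟨a, ha, hlt⟩ := exists_pos_forall_lt_edist (hS i) (hS j).isClosed (hdisj hij)
      exact ⟨a, ha, fun _ x hx y hy => (hlt x hx y hy).le⟩
  choose a ha hle using hpair
  cases isEmpty_or_nonempty (ι × ι) with
  | inl hempty => exact ⟨1, one_pos, fun i j => (hempty.false (i, j)).elim⟩
  | inr hnonempty =>
    obtain ⟨k, hk⟩ := Finite.exists_min a
    exact ⟨a k, ha k, fun i j hij x hx y hy =>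
      (ENNReal.coe_le_coe.2 (hk (i, j))).trans (hle (i, j) hij x hx y hy)⟩

theorem exists_pairwise_disjoint_subcover {ι κ X : Type*} [Nontrivial ι] [PseudoEMetricSpace X]
    {S : ι → Set X} (hS : ∀ i, (S i).Nonempty) {a : ℝ≥0∞}
    (hgap : ∀ i j, i ≠ j → ∀ x ∈ S i, ∀ y ∈ S j, a ≤ edist x y) {J : Finset κ} {U : κ → Set X}
    (hsmall : ∀ j ∈ J, ediam (U j) < a) (hU : ⋃ i, S i ⊆ ⋃ j ∈ J, U j) :
    ∃ I : ι → Finset κ, (∀ i, I i ⊂ J) ∧ Pairwise (fun i k => Disjoint (I i) (I k)) ∧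
      ∀ i, S i ⊆ ⋃ j ∈ I i, U j := by
  classical
  let I : ι → Finset κ := fun i => {j ∈ J | (S i ∩ U j).Nonempty}
  have hIJ : ∀ i, I i ⊆ J := fun i => Finset.filter_subset _ _
  have hIdisj : Pairwise fun i k => Disjoint (I i) (I k) := fun i k hik => by
    refine Finset.disjoint_left.2 fun j hi hk => ?_
    obtain ⟨hj, x, hx, hxU⟩ := Finset.mem_filter.1 hi
    obtain ⟨-, y, hy, hyU⟩ := Finset.mem_filter.1 hk
    exact (hsmall j hj).not_ge ((hgap i k hik x hx y hy).trans (edist_le_ediam_of_mem hxU hyU))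
  have hcover : ∀ i, S i ⊆ ⋃ j ∈ I i, U j := fun i x hx => by
    obtain ⟨j, hj, hxj⟩ := mem_iUnion₂.1 (hU (mem_iUnion_of_mem i hx))
    exact mem_iUnion₂.2 ⟨j, Finset.mem_filter.2 ⟨hj, x, hx, hxj⟩, hxj⟩
  refine ⟨I, fun i => (hIJ i).ssubset_of_ne fun heq => ?_, hIdisj, hcover⟩
  obtain ⟨k, hk⟩ := exists_ne i
  obtain ⟨x, hx⟩ := hS k
  obtain ⟨j, hj, -⟩ := mem_iUnion₂.1 (hcover k hx)
  exact Finset.disjoint_left.1 (hIdisj hk) hj (heq ▸ hIJ k hj)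

theorem nontrivial_of_one_le_sum_rpow {ι : Type*} [Fintype ι] {r : ι → ℝ≥0} (hr : ∀ i, r i < 1)
    {d : ℝ} (hd : 0 < d) (hsum : 1 ≤ ∑ i, r i ^ d) : Nontrivial ι := by
  by_contra! hsub
  rcases isEmpty_or_nonempty ι with hempty | ⟨⟨i⟩⟩
  · simp at hsum
  · rw [Fintype.sum_subsingleton _ i] at hsum
    exact hsum.not_gt (NNReal.rpow_lt_one (hr i) hd)

namespace IsAttractorOf

section BiLipschitz

variable {ι X Y : Type*} [PseudoMetricSpace X] {φ : ι → X → X} {r : ι → ℝ≥0} {L : Set X}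

-- A pair maximizing `a * dist u v - diam L * dist (f u) (f v)` cannot lie in a single piece
-- `φ i '' L` if the maximum is positive: pulling the pair back by `φ i` would increase the value.
theorem mul_dist_le_diam_mul_dist [PseudoMetricSpace Y] {f : X → Y} (hL : IsAttractorOf φ L)
    (hf : Continuous f) (hφ : ScalesBy φ r id) (hφf : ScalesBy φ r f) (hr : ∀ i, r i < 1)
    {a : ℝ} (ha : 0 ≤ a) (hgap : ∀ i j, i ≠ j → ∀ x ∈ φ i '' L, ∀ y ∈ φ j '' L,
      a ≤ dist (f x) (f y)) {u v : X} (hu : u ∈ L) (hv : v ∈ L) :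
    a * dist u v ≤ diam L * dist (f u) (f v) := by
  let G : X × X → ℝ := fun z => a * dist z.1 z.2 - diam L * dist (f z.1) (f z.2)
  have hG : Continuous G := by fun_prop
  obtain ⟨⟨x, y⟩, ⟨hx, hy⟩, hmax⟩ := (hL.isCompact.prod hL.isCompact).exists_isMaxOn
    (hL.nonempty.prod hL.nonempty) hG.continuousOn
  have hscale : ∀ i u v, G (φ i u, φ i v) = r i * G (u, v) := fun i u v => by
    have hdist : dist (φ i u) (φ i v) = r i * dist u v := hφ i u v
    simp only [G, hdist, hφf i u v]
    ring
  have hle : G (x, y) ≤ 0 := by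
    by_contra! hpos
    obtain ⟨i, x', hx', rfl⟩ := hL.exists_map_eq hx
    obtain ⟨j, y', hy', rfl⟩ := hL.exists_map_eq hy
    by_cases hij : i = j
    · subst hij
      have hpull : G (x', y') ≤ G (φ i x', φ i y') := hmax (mk_mem_prod hx' hy')
      rw [hscale] at hpos hpull
      have hpos' : 0 < G (x', y') := pos_of_mul_pos_right hpos (r i).coe_nonneg
      exact hpull.not_gt (mul_lt_of_lt_one_left hpos' (hr i))
    · have hfar := mul_le_mul (dist_le_diam_of_mem hL.isCompact.isBounded hx hy)
        (hgap i j hij _ (mem_image_of_mem _ hx') _ (mem_image_of_mem _ hy')) ha diam_nonneg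
      simp only [G] at hpos
      linarith
  exact sub_nonpos.1 ((hmax (mk_mem_prod hu hv)).trans hle)

theorem biLipschitzOn [Finite ι] [MetricSpace Y] {f : X → Y} {C : ℝ≥0} (hL : IsAttractorOf φ L)
    (hf : LipschitzWith C f) (hφ : ScalesBy φ r id) (hφf : ScalesBy φ r f) (hr : ∀ i, r i < 1)
    (hdisj : Pairwise fun i j => Disjoint (f '' (φ i '' L)) (f '' (φ j '' L))) :
    BiLipschitzOn f L := by
  refine ⟨⟨C, hf.lipschitzOnWith⟩, ?_⟩
  obtain ⟨a, ha, hgap⟩ := exists_pos_forall_le_edist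
    (fun i => (hL.isCompact.image (hφ.lipschitzWith i).continuous).image hf.continuous) hdisj
  have hgap' : ∀ i j, i ≠ j → ∀ x ∈ φ i '' L, ∀ y ∈ φ j '' L, (a : ℝ) ≤ dist (f x) (f y) :=
    fun i j hij x hx y hy => by
      have := hgap i j hij _ (mem_image_of_mem f hx) _ (mem_image_of_mem f hy)
      rw [edist_nndist] at this
      exact_mod_cast this
  refine ⟨(diam L).toNNReal / a, AntilipschitzWith.of_le_mul_dist fun u v => ?_⟩
  have hle := hL.mul_dist_le_diam_mul_dist hf.continuous hφ hφf hr a.coe_nonneg hgap' u.2 v.2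
  rw [NNReal.coe_div, Real.coe_toNNReal _ diam_nonneg, div_mul_eq_mul_div,
    le_div_iff₀ (NNReal.coe_pos.2 ha), mul_comm]
  exact hle

end BiLipschitz

section Dimension

variable {ι X : Type*} [Fintype ι] {φ : ι → X → X} {r : ι → ℝ≥0} {L : Set X}

-- Strong induction on the cover: unless some covering set has diameter at least the gap `a`, the
-- cover splits into disjoint smaller covers of the pieces `φ i '' L`.
theorem rpow_le_sum_ediam_rpow [PseudoMetricSpace X] (hL : IsAttractorOf φ L)
    (hφ : ScalesBy φ r id) (hr0 : ∀ i, 0 < r i) (hr1 : ∀ i, r i < 1) {d : ℝ} (hd : 0 < d)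
    (hsum : 1 ≤ ∑ i, r i ^ d) {a : ℝ≥0∞}
    (hgap : ∀ i j, i ≠ j → ∀ x ∈ φ i '' L, ∀ y ∈ φ j '' L, a ≤ edist x y) {κ : Type*}
    (J : Finset κ) (U : κ → Set X) (hU : L ⊆ ⋃ j ∈ J, U j) :
    a ^ d ≤ ∑ j ∈ J, ediam (U j) ^ d := by
  classical
  have : Nontrivial ι := nontrivial_of_one_le_sum_rpow hr1 hd hsum
  induction J using Finset.strongInduction generalizing U with
  | H J ih =>
  by_cases! hbig : ∃ j ∈ J, a ≤ ediam (U j)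
  · obtain ⟨j, hj, hja⟩ := hbig
    exact (ENNReal.rpow_le_rpow hja hd.le).trans
      (Finset.single_le_sum (f := fun j => ediam (U j) ^ d) (fun _ _ => zero_le) hj)
  obtain ⟨I, hIJ, hIdisj, hIcover⟩ := exists_pairwise_disjoint_subcover
    (fun i => hL.nonempty.image (φ i)) hgap hbig (hL.2.2 ▸ hU)
  calc a ^ d ≤ ((∑ i, r i ^ d : ℝ≥0) : ℝ≥0∞) * a ^ d :=
        le_mul_of_one_le_left' (by exact_mod_cast hsum)
    _ = ∑ i, (r i : ℝ≥0∞) ^ d * a ^ d := by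
        simp_rw [ENNReal.ofNNReal_finsetSum, Finset.sum_mul, ENNReal.coe_rpow_of_nonneg _ hd.le]
    _ ≤ ∑ i, (r i : ℝ≥0∞) ^ d * ∑ j ∈ I i, ediam (φ i ⁻¹' U j) ^ d := by
        gcongr with i
        refine ih (I i) (hIJ i) _ ?_
        simpa only [image_subset_iff, preimage_iUnion] using hIcover i
    _ ≤ ∑ i, ∑ j ∈ I i, ediam (U j) ^ d :=
        Finset.sum_le_sum fun i _ => hφ.rpow_mul_sum_ediam_preimage_le (hr0 i) hd.le _ U
    _ = ∑ j ∈ Finset.univ.biUnion I, ediam (U j) ^ d :=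
        (Finset.sum_biUnion fun i _ k _ hik => hIdisj hik).symm
    _ ≤ ∑ j ∈ J, ediam (U j) ^ d :=
        Finset.sum_le_sum_of_subset (Finset.biUnion_subset.2 fun i _ => (hIJ i).1)

theorem le_dimH [MetricSpace X] (hL : IsAttractorOf φ L) (hφ : ScalesBy φ r id)
    (hr0 : ∀ i, 0 < r i) (hr1 : ∀ i, r i < 1)
    (hdisj : Pairwise fun i j => Disjoint (φ i '' L) (φ j '' L)) {d : ℝ≥0}
    (hsum : 1 ≤ ∑ i, r i ^ (d : ℝ)) : d ≤ dimH L := by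
  rcases eq_zero_or_pos d with rfl | hd
  · simp
  borelize X
  obtain ⟨a, ha, hgap⟩ := exists_pos_forall_le_edist
    (fun i => hL.isCompact.image (hφ.lipschitzWith i).continuous) hdisj
  have hμ : (a : ℝ≥0∞) ^ (d : ℝ) ≤ MeasureTheory.Measure.hausdorffMeasure (d : ℝ) L :=
    le_hausdorffMeasure_of_forall_finite_cover hL.isCompact hd
      (hL.rpow_le_sum_ediam_rpow hφ hr0 hr1 hd hsum hgap)
  have hpos : 0 < (a : ℝ≥0∞) ^ (d : ℝ) :=
    ENNReal.rpow_pos (ENNReal.coe_pos.2 ha) ENNReal.coe_ne_top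
  exact le_dimH_of_hausdorffMeasure_ne_zero (hpos.trans_le hμ).ne'

end Dimension

end IsAttractorOf

theorem exists_isAttractorOf_subset_le_dimH_biLipschitzOn {ι X Y : Type*} [Fintype ι]
    [MetricSpace X] [MetricSpace Y] {φ : ι → X → X} {r : ι → ℝ≥0} {f : X → Y} {C : ℝ≥0}
    (hf : LipschitzWith C f) (hφ : ScalesBy φ r id) (hφf : ScalesBy φ r f) (hr0 : ∀ i, 0 < r i)
    (hr1 : ∀ i, r i < 1) {K : Set X} (hK : IsCompact K) (hne : K.Nonempty)
    (hmaps : ∀ i, MapsTo (φ i) K K)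
    (hdisj : Pairwise fun i j => Disjoint (f '' (φ i '' K)) (f '' (φ j '' K))) {d : ℝ≥0}
    (hsum : 1 ≤ ∑ i, r i ^ (d : ℝ)) :
    ∃ L, IsAttractorOf φ L ∧ L ⊆ K ∧ d ≤ dimH L ∧ BiLipschitzOn f L := by
  have : Nonempty ι := by
    by_contra! hempty
    simp at hsum
  obtain ⟨L, hL, hLK⟩ := exists_isAttractorOf_subset (fun i => (hφ.lipschitzWith i).continuous)
    (fun i => (hφ.antilipschitzWith (hr0 i)).injective) hK hne hmaps
  have hdisjL : Pairwise fun i j => Disjoint (f '' (φ i '' L)) (f '' (φ j '' L)) :=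
    fun i j hij => (hdisj hij).mono (by gcongr) (by gcongr)
  exact ⟨L, hL, hLK, hL.le_dimH hφ hr0 hr1 (fun i j hij => (hdisjL hij).of_image) hsum,
    hL.biLipschitzOn hf hφ hφf hr1 hdisjL⟩

/-- The composition `φ i₁ ∘ ⋯ ∘ φ iₙ` of the maps of a family along a word `[i₁, …, iₙ]`; if `φ i`
has ratio `r i`, the composition has ratio `(l.map r).prod`. -/
def wordMap {ι X : Type*} (φ : ι → X → X) (l : List ι) (x : X) : X :=
  l.foldr φ x

theorem mapsTo_wordMap {ι X : Type*} {φ : ι → X → X} {S : Set X} (h : ∀ i, MapsTo (φ i) S S) :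
    ∀ l, MapsTo (wordMap φ l) S S
  | [] => mapsTo_id S
  | i :: l => (h i).comp (mapsTo_wordMap h l)

theorem scalesBy_wordMap {ι X Y : Type*} [PseudoMetricSpace Y] {φ : ι → X → X} {r : ι → ℝ≥0}
    {g : X → Y} (h : ScalesBy φ r g) : ScalesBy (wordMap φ) (fun l => (l.map r).prod) g := by
  intro l x y
  induction l with
  | nil => simp [wordMap]
  | cons i l ih =>
    calc dist (g (wordMap φ (i :: l) x)) (g (wordMap φ (i :: l) y))
        = r i * dist (g (wordMap φ l x)) (g (wordMap φ l y)) := h i _ _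
      _ = ((i :: l).map r).prod * dist (g x) (g y) := by
          rw [ih, List.map_cons, List.prod_cons, NNReal.coe_mul, mul_assoc]

namespace IsAttractorOf

variable {ι X Y : Type*} [Finite ι] [TopologicalSpace X] {φ : ι → X → X} {r : ι → ℝ≥0} {K : Set X}

-- Each point has nested cylinders around it; stop at the first one of ratio at most `δ`.
theorem exists_word_of_scale (hK : IsAttractorOf φ K) (hr0 : ∀ i, 0 < r i) (hr1 : ∀ i, r i < 1) :
    ∃ m : ℝ≥0, 0 < m ∧ ∀ δ : ℝ≥0, 0 < δ → δ ≤ 1 → ∀ x ∈ K, ∃ l : List ι,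
      m * δ ≤ (l.map r).prod ∧ (l.map r).prod ≤ δ ∧ x ∈ wordMap φ l '' K := by
  obtain ⟨i₀, -⟩ := hK.exists_map_eq hK.nonempty.some_mem
  have : Nonempty ι := ⟨i₀⟩
  obtain ⟨imin, hmin⟩ := Finite.exists_min r
  obtain ⟨imax, hmax⟩ := Finite.exists_max r
  have hword : ∀ n : ℕ, ∀ δ : ℝ≥0, r imax ^ n ≤ δ → δ ≤ 1 → ∀ x ∈ K, ∃ l : List ι,
      r imin * δ ≤ (l.map r).prod ∧ (l.map r).prod ≤ δ ∧ x ∈ wordMap φ l '' K := by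
    intro n
    induction n with
    | zero =>
      intro δ hδ hδ1 x hx
      obtain rfl : δ = 1 := le_antisymm hδ1 (by simpa using hδ)
      exact ⟨[], by simpa using (hr1 imin).le, by simp, x, hx, rfl⟩
    | succ n ih =>
      intro δ hδ hδ1 x hx
      obtain ⟨i, y, hy, rfl⟩ := hK.exists_map_eq hx
      rcases le_or_gt (r i) δ with hi | hi
      · exact ⟨[i], by simpa using (mul_le_of_le_one_right' hδ1).trans (hmin i), by simpa using hi,
          y, hy, rfl⟩
      have hn : r imax ^ n ≤ δ / r i := by
        rw [le_div_iff₀ (hr0 i)]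
        calc r imax ^ n * r i ≤ r imax ^ n * r imax := by gcongr; exact hmax i
          _ ≤ δ := by rwa [← pow_succ]
      obtain ⟨l, hlow, hup, z, hz, rfl⟩ := ih (δ / r i) hn (div_le_one_of_le₀ hi.le zero_le) y hy
      refine ⟨i :: l, ?_, ?_, z, hz, rfl⟩
      · rwa [List.map_cons, List.prod_cons, ← div_le_iff₀' (hr0 i), mul_div_assoc]
      · rwa [List.map_cons, List.prod_cons, ← le_div_iff₀' (hr0 i)]
  refine ⟨r imin, hr0 imin, fun δ hδ hδ1 => ?_⟩
  obtain ⟨n, hn⟩ := exists_pow_lt_of_lt_one hδ (hr1 imax)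
  exact hword n δ hn.le hδ1

theorem exists_separated_words_of_lt_dimH [MetricSpace Y] {f : X → Y} (hK : IsAttractorOf φ K)
    (hf : Continuous f) (hφf : ScalesBy φ r f) (hr0 : ∀ i, 0 < r i) (hr1 : ∀ i, r i < 1)
    {B : Set X} (hKB : K ⊆ B) (hB : Bornology.IsBounded (f '' B)) {d : ℝ≥0}
    (hd : d < dimH (f '' K)) :
    ∃ (p : ℕ) (l : Fin p → List ι), (∀ j, ((l j).map r).prod < 1) ∧
      Pairwise (fun i j =>
        Disjoint (f '' (wordMap φ (l i) '' B)) (f '' (wordMap φ (l j) '' B))) ∧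
      1 ≤ ∑ j, ((l j).map r).prod ^ (d : ℝ) := by
  obtain ⟨A, hA, hdiam⟩ : ∃ A : ℝ≥0, 0 < A ∧ diam (f '' B) ≤ A :=
    ⟨(diam (f '' B)).toNNReal + 1, by positivity, (Real.le_coe_toNNReal _).trans (by simp)⟩
  obtain ⟨m, hm, hword⟩ := hK.exists_word_of_scale hr0 hr1
  obtain ⟨δ, hδ, hδA, T, hTK, hsep, hcard⟩ := exists_isSeparated_of_lt_dimH
    (hK.isCompact.image hf).totallyBounded hd (c := m / (2 * A)) (δ₀ := 2 * A)
    (by positivity) (by positivity)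
  have hscale : δ / (2 * A) < 1 := (div_lt_one (by positivity)).2 hδA
  have hpick : ∀ y : T, ∃ l : List ι, m * (δ / (2 * A)) ≤ (l.map r).prod ∧
      (l.map r).prod ≤ δ / (2 * A) ∧ ∃ z ∈ K, f (wordMap φ l z) = y := by
    rintro ⟨y, hy⟩
    obtain ⟨x, hx, rfl⟩ := hTK hy
    obtain ⟨l, hlow, hup, z, hz, rfl⟩ := hword _ (by positivity) hscale.le x hx
    exact ⟨l, hlow, hup, z, hz, rfl⟩
  choose l hlow hup z hz hzy using hpick
  have hnear : ∀ y : T, f '' (wordMap φ (l y) '' B) ⊆ closedBall (y : Y) (δ / 2) := by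
    intro y
    rw [← hzy y]
    refine ((scalesBy_wordMap hφf).image_image_subset_closedBall hB (hKB (hz y)) (l y)).trans
      (closedBall_subset_closedBall ?_)
    calc (((l y).map r).prod : ℝ) * diam (f '' B) ≤ (δ / (2 * A) : ℝ≥0) * A :=
          mul_le_mul (hup y) hdiam diam_nonneg (NNReal.coe_nonneg _)
      _ = δ / 2 := by
          push_cast
          field_simp
  let e : Fin T.card ≃ T := T.equivFin.symm
  refine ⟨T.card, fun j => l (e j), fun j => (hup _).trans_lt hscale, fun i j hij => ?_, ?_⟩
  · have hfar : (δ : ℝ≥0∞) < edist (e i : Y) (e j) :=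
      hsep (e i).2 (e j).2 fun h => hij (e.injective (Subtype.ext h))
    rw [edist_nndist, ENNReal.coe_lt_coe, ← NNReal.coe_lt_coe, coe_nndist] at hfar
    exact (closedBall_disjoint_closedBall (by rwa [add_halves])).mono (hnear _) (hnear _)
  · calc 1 ≤ (T.card : ℝ≥0) * (m / (2 * A) * δ) ^ (d : ℝ) := hcard
      _ = ∑ _j : Fin T.card, (m * (δ / (2 * A))) ^ (d : ℝ) := by
          rw [div_mul_eq_mul_div, ← mul_div_assoc]
          simp
      _ ≤ ∑ j, ((l (e j)).map r).prod ^ (d : ℝ) := by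
          gcongr with j
          exact hlow (e j)

theorem exists_separated_words_dimH_le [MetricSpace Y] {f : X → Y} (hK : IsAttractorOf φ K)
    (hf : Continuous f) (hφf : ScalesBy φ r f) (hr0 : ∀ i, 0 < r i) (hr1 : ∀ i, r i < 1)
    {B : Set X} (hKB : K ⊆ B) (hB : Bornology.IsBounded (f '' B)) (hdim : dimH (f '' K) ≠ ⊤)
    {ε : ℝ≥0∞} (hε : ε ≠ 0) :
    ∃ (p : ℕ) (l : Fin p → List ι) (d : ℝ≥0), (∀ j, ((l j).map r).prod < 1) ∧
      Pairwise (fun i j =>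
        Disjoint (f '' (wordMap φ (l i) '' B)) (f '' (wordMap φ (l j) '' B))) ∧
      1 ≤ ∑ j, ((l j).map r).prod ^ (d : ℝ) ∧ dimH (f '' K) ≤ d + ε := by
  rcases eq_or_ne (dimH (f '' K)) 0 with hzero | hpos
  · obtain ⟨i, -⟩ := hK.exists_map_eq hK.nonempty.some_mem
    exact ⟨1, fun _ => [i], 0, by simpa using hr1 i,
      fun j k hjk => absurd (Subsingleton.elim j k) hjk, by simp, by simp [hzero]⟩
  · obtain ⟨d, hd, hdK⟩ := ENNReal.lt_iff_exists_nnreal_btwn.1 (ENNReal.sub_lt_self hdim hpos hε)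
    obtain ⟨p, l, hl, hdisj, hsum⟩ :=
      hK.exists_separated_words_of_lt_dimH hf hφf hr0 hr1 hKB hB hdK
    exact ⟨p, l, d, hl, hdisj, hsum, tsub_le_iff_right.1 hd.le⟩

end IsAttractorOf

/-- The homotheties `x ↦ r i • x + w i`, that is, similarities without rotations, in any normed
space; `HomothetyIFS.map` is such a family on `E3`. -/
def homothetyFamily {ι E : Type*} [NormedAddCommGroup E] [NormedSpace ℝ E] (r : ι → ℝ≥0)
    (w : ι → E) (i : ι) (x : E) : E :=
  (r i : ℝ) • x + w i

section Homothety

variable {ι E F : Type*} [NormedAddCommGroup E] [NormedSpace ℝ E]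

theorem scalesBy_homothetyFamily [NormedAddCommGroup F] [NormedSpace ℝ F] (r : ι → ℝ≥0)
    (w : ι → E) (f : E →L[ℝ] F) : ScalesBy (homothetyFamily r w) r f := fun i x y => by
  simp [homothetyFamily, dist_eq_norm, ← smul_sub, norm_smul]

theorem wordMap_homothetyFamily (r : ι → ℝ≥0) (w : ι → E) (l : List ι) :
    wordMap (homothetyFamily r w) l =
      homothetyFamily (fun l => (l.map r).prod) (fun l => wordMap (homothetyFamily r w) l 0) l := by
  funext x
  induction l with
  | nil => simp [wordMap, homothetyFamily]
  | cons i l ih =>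
    calc (r i : ℝ) • wordMap (homothetyFamily r w) l x + w i
        = (r i : ℝ) • (((l.map r).prod : ℝ) • x + wordMap (homothetyFamily r w) l 0) + w i := by
          rw [ih, homothetyFamily]
      _ = (((i :: l).map r).prod : ℝ) • x + homothetyFamily r w i
            (wordMap (homothetyFamily r w) l 0) := by
          simp [homothetyFamily, smul_smul, add_assoc]

end Homothety

theorem proposition4p6_general {ι E F : Type*} [Finite ι] [NormedAddCommGroup E] [NormedSpace ℝ E]
    [NormedAddCommGroup F] [NormedSpace ℝ F] [FiniteDimensional ℝ F] (f : E →L[ℝ] F)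
    {r : ι → ℝ≥0} {w : ι → E} (hr0 : ∀ i, 0 < r i) (hr1 : ∀ i, r i < 1) {K : Set E}
    (hK : IsAttractorOf (homothetyFamily r w) K) {B : Set E} (hB : Bornology.IsBounded B)
    (hBmaps : ∀ i, MapsTo (homothetyFamily r w i) B B) {ε : ℝ≥0∞} (hε : ε ≠ 0) :
    ∃ (p : ℕ) (ρ : Fin p → ℝ≥0) (v : Fin p → E) (L : Set E),
      (∀ j, 0 < ρ j) ∧ (∀ j, ρ j < 1) ∧ IsAttractorOf (homothetyFamily ρ v) L ∧ L ⊆ K ∧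
      (∀ j, MapsTo (homothetyFamily ρ v j) B B) ∧
      Pairwise (fun i j =>
        Disjoint (homothetyFamily ρ v i '' B) (homothetyFamily ρ v j '' B)) ∧
      dimH (f '' K) ≤ dimH L + ε ∧ BiLipschitzOn f L := by
  obtain ⟨p, l, d, hρ1, hdisj, hsum, hd⟩ := hK.exists_separated_words_dimH_le f.continuous
    (scalesBy_homothetyFamily r w f) hr0 hr1 subset_union_left
    (f.lipschitz.isBounded_image (hK.isCompact.isBounded.union hB)) (Real.dimH_ne_top _) hε
  let ρ : Fin p → ℝ≥0 := fun j => ((l j).map r).prod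
  let v : Fin p → E := fun j => wordMap (homothetyFamily r w) (l j) 0
  have hρ0 : ∀ j, 0 < ρ j := fun j => List.prod_pos (by simpa using fun i _ => hr0 i)
  have hword : ∀ j, homothetyFamily ρ v j = wordMap (homothetyFamily r w) (l j) :=
    fun j => (wordMap_homothetyFamily r w (l j)).symm
  simp only [← hword] at hdisj
  obtain ⟨L, hL, hLK, hdL, hbi⟩ := exists_isAttractorOf_subset_le_dimH_biLipschitzOn f.lipschitz
    (scalesBy_homothetyFamily ρ v (.id ℝ E)) (scalesBy_homothetyFamily ρ v f) hρ0 hρ1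
    hK.isCompact hK.nonempty (fun j => hword j ▸ mapsTo_wordMap hK.mapsTo (l j))
    (fun i j hij => (hdisj hij).mono (by gcongr; exact subset_union_left)
      (by gcongr; exact subset_union_left)) hsum
  exact ⟨p, ρ, v, L, hρ0, hρ1, hL, hLK, fun j => hword j ▸ mapsTo_wordMap hBmaps (l j),
    fun i j hij => (hdisj hij).of_image.mono (by gcongr; exact subset_union_right)
      (by gcongr; exact subset_union_right), hd.trans (by gcongr), hbi⟩

theorem proposition4p6 {q : ℕ} (Ψ : HomothetyIFS q) (K : Set E3) (hK : Ψ.IsAttractor K) :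
    HasBiLipschitzProperty K ∧
      ∀ V : Submodule ℝ E3, Module.finrank ℝ V = 2 → ∀ ε : ℝ, 0 < ε →
        ∀ R : ℝ, 0 < R → Ψ.PreservesBall R →
          ∃ (p : ℕ) (Φ : HomothetyIFS p) (L : Set E3),
            Φ.IsAttractor L ∧ L ⊆ K ∧ Φ.VerySeparated R ∧
            dimH (V.orthogonalProjectionOnto '' K) ≤ dimH L + ENNReal.ofReal ε ∧
            BiLipschitzOn V.orthogonalProjectionOnto L := by
  have main := fun (V : Submodule ℝ E3) (ε : ℝ) (hε : 0 < ε) (R : ℝ) (hΨ : Ψ.PreservesBall R) =>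
    proposition4p6_general V.orthogonalProjectionOnto
      (r := fun i => .mk (Ψ.ratio i) (Ψ.ratio_pos i).le) Ψ.ratio_pos Ψ.ratio_lt_one hK
      isBounded_closedBall hΨ (ENNReal.ofReal_pos.2 hε).ne'
  refine ⟨fun V _ ε hε => ?_, fun V _ ε hε R _ hΨ => ?_⟩
  · obtain ⟨R, -, hΨ⟩ := Ψ.exists_preservesBall
    obtain ⟨-, -, -, L, -, -, -, hLK, -, -, hdim, hbi⟩ := main V ε hε R hΨ
    exact ⟨L, hLK, hdim, hbi⟩
  · obtain ⟨p, ρ, v, L, hρ0, hρ1, hL, hLK, hmaps, hdisj, hdim, hbi⟩ := main V ε hε R hΨ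
    exact ⟨p, ⟨fun j => ρ j, v, hρ0, hρ1⟩, L, hL, hLK, ⟨hmaps, hdisj⟩, hdim, hbi⟩
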